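/- Let $L,\mu>0$, $\alpha\ge 3$ and $\beta>0$. Then there exist constants $C,K>0$, depending only on $\alpha,\beta,L,\mu$, with the following property. Let $\phi:\mathbb R^n\to\mathbb R$ be convex and twice continuously differentiable, with $\nabla\phi$ Lipschitz-continuous with constant $L$ (Euclidean norm). Assume that $\phi$ attains its minimum value $\phi^*$, write $\operatorname{argmin}(\phi)$ for the set of its minimizers, and assume that $$\mu\,(\phi(z)-\phi^*)\le\tfrac12\|\nabla\phi(z)\|^2\qquad\text{for all } z\in\mathbb R^n.$$ For $z\in\mathbb R^n$ let $y_z\in\mathcal C^2((0,\infty);\mathbb R^n)\cap\mathcal C^1([0,\infty);\mathbb R^n)$ be the (unique) solution of $$\ddot y(t)+\frac{\alpha}{t}\dot y(t)+\nabla\phi(y(t))+\beta\nabla^2\phi(y(t))\dot y(t)=0\quad(t>0),\qquad y(0)=z,\quad \dot y(0)=0,$$ and set $$T(z)=\inf\Big\{t>0:\ \frac{d}{dt}\|\dot y_z(t)\|^2\le 0\Big\}.$$ Given $x_0\in\mathbb R^n$, put $S_0=0$ and, for $i\ge0$, $S_{i+1}=S_i+T(x_i)$ and $x_{i+1}=y_{x_i}(T(x_i))$.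 The speed-restarted trajectory $\chi_{x_0}:[0,\infty)\to\mathbb R^n$ is given by $\chi_{x_0}(0)=x_0$ and $\chi_{x_0}(t)=y_{x_i}(t-S_i)$ for $t\in(S_i,S_{i+1}]$, $i\ge 0$; if $x_0\in\operatorname{argmin}(\phi)$ (so that $T(x_0)=0$), it is the constant trajectory $\chi_{x_0}\equiv x_0$. Then, for every $x_0\in\mathbb R^n$ and every $t>0$, $$\phi(\chi_{x_0}(t))-\phi^*\ \le\ Ce^{-Kt}\big(\phi(x_0)-\phi^*\big)\ \le\ \frac{CL}{2}e^{-Kt}\operatorname{dist}\big(x_0,\operatorname{argmin}(\phi)\big)^2 .$$ -/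

import Mathlib

open scoped NNReal

noncomputable section

namespace DinAvd

variable {n : ℕ}

/-- The set of (global) minimizers of `φ`. -/
def argmin (φ : EuclideanSpace ℝ (Fin n) → ℝ) : Set (EuclideanSpace ℝ (Fin n)) :=
  {x | ∀ y, φ x ≤ φ y}

/-- The Hessian `∇²φ(x)`, as the derivative of the gradient at `x`. -/
def hessian (φ : EuclideanSpace ℝ (Fin n) → ℝ) (x : EuclideanSpace ℝ (Fin n)) :
    EuclideanSpace ℝ (Fin n) →L[ℝ] EuclideanSpace ℝ (Fin n) :=
  fderiv ℝ (gradient φ) x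

/-- `y` is a solution of
`y''(t) + (α / t) y'(t) + ∇φ(y(t)) + β ∇²φ(y(t)) y'(t) = 0` for `t > 0`,
`y(0) = z`, `y'(0) = 0`, of class `C²` on `(0, ∞)` and `C¹` on `[0, ∞)`.
Only the values of `y` on `[0, ∞)` matter; the derivative at `0` is one-sided. -/
structure IsSolution (φ : EuclideanSpace ℝ (Fin n) → ℝ) (α β : ℝ)
    (z : EuclideanSpace ℝ (Fin n)) (y : ℝ → EuclideanSpace ℝ (Fin n)) : Prop where
  contDiffOn_Ici : ContDiffOn ℝ 1 y (Set.Ici 0)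
  contDiffOn_Ioi : ContDiffOn ℝ 2 y (Set.Ioi 0)
  initial_position : y 0 = z
  initial_velocity : HasDerivWithinAt y 0 (Set.Ici 0) 0
  equation : ∀ t : ℝ, 0 < t →
    deriv (deriv y) t + (α / t) • deriv y t + gradient φ (y t)
      + β • hessian φ (y t) (deriv y t) = 0

/-- The solution `y_z` started at `z` with zero velocity. (For convex `C²` functions with Lipschitz
gradient and a minimizer, the initial value problem has exactly one solution on `[0, ∞)`.) -/
def solution (φ : EuclideanSpace ℝ (Fin n) → ℝ) (α β : ℝ)
    (z : EuclideanSpace ℝ (Fin n)) : ℝ → EuclideanSpace ℝ (Fin n) :=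
  Classical.epsilon (IsSolution φ α β z)

/-- The restarting time `T(z) = inf {t > 0 : d/dt ‖y_z'(t)‖² ≤ 0}`. -/
def restartTime (φ : EuclideanSpace ℝ (Fin n) → ℝ) (α β : ℝ)
    (z : EuclideanSpace ℝ (Fin n)) : ℝ :=
  sInf {t : ℝ | 0 < t ∧ deriv (fun s => ‖deriv (solution φ α β z) s‖ ^ 2) t ≤ 0}

/-- The restart points: the given `x₀`, then `x_{i+1} = y_{x_i}(T(x_i))`. -/
def restartPoint (φ : EuclideanSpace ℝ (Fin n) → ℝ) (α β : ℝ)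
    (x₀ : EuclideanSpace ℝ (Fin n)) : ℕ → EuclideanSpace ℝ (Fin n)
  | 0 => x₀
  | i + 1 => solution φ α β (restartPoint φ α β x₀ i)
      (restartTime φ α β (restartPoint φ α β x₀ i))

/-- The instants of restart `S_i = T(x_0) + ⋯ + T(x_{i-1})`; in particular `S_0 = 0`. -/
def restartInstant (φ : EuclideanSpace ℝ (Fin n) → ℝ) (α β : ℝ)
    (x₀ : EuclideanSpace ℝ (Fin n)) (i : ℕ) : ℝ :=
  ∑ j ∈ Finset.range i, restartTime φ α β (restartPoint φ α β x₀ j)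

open Classical in
/-- The restarted trajectory: `χ(t) = y_{x_i}(t - S_i)` for `t ∈ (S_i, S_{i+1}]`, and `χ(0) = x₀`.
Since `T ≥ 0`, the intervals `(S_i, S_{i+1}]` are pairwise disjoint. If `x₀` is a minimizer, then
`y_{x₀}` is constant and `T(x₀) = 0`, no time `t > 0` lies in any of these intervals, and `χ` is the
constant (stationary) trajectory `x₀`. -/
def restartedTrajectory (φ : EuclideanSpace ℝ (Fin n) → ℝ) (α β : ℝ)
    (x₀ : EuclideanSpace ℝ (Fin n)) (t : ℝ) : EuclideanSpace ℝ (Fin n) :=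
  if h : ∃ i : ℕ, t ∈ Set.Ioc (restartInstant φ α β x₀ i) (restartInstant φ α β x₀ (i + 1)) then
    solution φ α β (restartPoint φ α β x₀ (Nat.find h)) (t - restartInstant φ α β x₀ (Nat.find h))
  else x₀

end DinAvd

end

/-! Everything rests on the energy identity `⟪∇φ(y), V⟫ = -⟪V, A⟫ - (α/t)‖V‖² - β⟪∇²φ(y)V, V⟫`,
where `V` and `A` are velocity and acceleration. Before a restart `⟪V, A⟫ ≥ 0`, and convexity makes
the Hessian term nonnegative, so `φ` falls at rate at least `(α/t)‖V‖²` while the speed does not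
decrease. Hence a speed bound `‖V‖ ≥ c'` on `[a, b]` costs `φ` at least `α c'² log(b/a)`
(`IsMotion.add_log_le`).

Up to a time `τ` depending only on `α, β, L`, the motion is close to `V = t p`, `A = p` with `p =
-∇φ(z)/(α+1)` (`IsMotion.velocity_acceleration_near`). So the speed increases on `(0, τ]` and is
comparable to `t‖∇φ(z)‖` there. Together with the gradient inequality, this gives the bounds for one
cycle (`IsMotion.restart_cycle`): it lasts at least `τ`; the logarithmic loss would exceed the whole
gap if it lasted too long; and the loss on `[τ/2, τ]` alone contracts the gap by a fixed factor.
Iterating gives exponential decay.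

Because the trajectory is built from a chosen solution, existence is proved too: integrating against
`t^α` turns the equation, singular at `0`, into a first-order causal equation, solved by
contraction. -/

/-! ### Causal first-order equations: contraction in an exponentially weighted norm -/

section Volterra

variable {E : Type*} [NormedAddCommGroup E] [NormedSpace ℝ E]

open BoundedContinuousFunction

/-- An exponential weight whose logarithmic derivative is `2 * K * (1 + t)`. -/
noncomputable def volterraWeight (K t : ℝ) : ℝ := Real.exp (K * (2 * t + t ^ 2))

theorem continuous_volterraWeight (K : ℝ) : Continuous (volterraWeight K) := by
  unfold volterraWeight; fun_prop

theorem volterraWeight_pos (K t : ℝ) : 0 < volterraWeight K t := Real.exp_pos _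

theorem volterraWeight_mono {K s t : ℝ} (hK : 0 < K) (hs : 0 ≤ s) (hst : s ≤ t) :
    volterraWeight K s ≤ volterraWeight K t := by
  unfold volterraWeight
  gcongr

theorem one_le_volterraWeight {K t : ℝ} (hK : 0 < K) (ht : 0 ≤ t) : 1 ≤ volterraWeight K t :=
  Real.one_le_exp (by positivity)

theorem hasDerivAt_volterraWeight {K : ℝ} (hK : 0 < K) (t : ℝ) :
    HasDerivAt (fun t => volterraWeight K t / (2 * K)) ((1 + t) * volterraWeight K t) t := by
  unfold volterraWeight
  have h1 : HasDerivAt (fun t : ℝ => K * (2 * t + t ^ 2)) (K * (2 * 1 + 2 * t)) t := by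
    have := (((hasDerivAt_id t).const_mul 2).add ((hasDerivAt_id t).pow 2)).const_mul K
    simpa using this
  exact (h1.exp.div_const (2 * K)).congr_deriv (by field_simp)

/-- Integration against the weight gains a factor `1 / (2 * K)`, which turns the Lipschitz bound `K
* (1 + s)` into a contraction of ratio `1 / 2` on the whole half-line at once. -/
theorem norm_integral_le_volterraWeight {K c t : ℝ} (hK : 0 < K) (hc : 0 ≤ c) (ht : 0 ≤ t)
    {f : ℝ → E} (hf : ∀ s, 0 ≤ s → ‖f s‖ ≤ c * ((1 + s) * volterraWeight K s)) :
    ‖∫ s in (0 : ℝ)..t, f s‖ ≤ c * (volterraWeight K t / (2 * K)) := by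
  have hcw := continuous_volterraWeight K
  have hi : IntervalIntegrable (fun s => (1 + s) * volterraWeight K s)
      MeasureTheory.volume 0 t := Continuous.intervalIntegrable (by fun_prop) _ _
  have h1 : ‖∫ s in (0 : ℝ)..t, f s‖
      ≤ ∫ s in (0 : ℝ)..t, c * ((1 + s) * volterraWeight K s) :=
    intervalIntegral.norm_integral_le_of_norm_le ht
      (Filter.Eventually.of_forall fun s hs => hf s hs.1.le) (hi.const_mul c)
  rw [intervalIntegral.integral_const_mul,
    intervalIntegral.integral_eq_sub_of_hasDerivAt
      (fun s _ => hasDerivAt_volterraWeight hK s) hi] at h1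
  refine h1.trans (mul_le_mul_of_nonneg_left ?_ hc)
  have := volterraWeight_pos K 0
  have : 0 < volterraWeight K 0 / (2 * K) := by positivity
  linarith

/-- Global solvability of `y' = F y`, `y 0 = z` for a causal operator `F` with a Lipschitz constant
growing at most linearly in time. -/
theorem exists_volterra_solution [CompleteSpace E] {F : (ℝ → E) → ℝ → E} {K M : ℝ} {z : E}
    (hK : 0 < K)
    (hcont : ∀ y, Continuous y → Continuous (F y))
    (hlip : ∀ y₁ y₂, Continuous y₁ → Continuous y₂ → ∀ s, 0 ≤ s → ∀ D,
      (∀ r, 0 ≤ r → r ≤ s → ‖y₁ r - y₂ r‖ ≤ D) → ‖F y₁ s - F y₂ s‖ ≤ K * (1 + s) * D)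
    (hz : ∀ s, 0 ≤ s → ‖F (fun _ => z) s‖ ≤ M * (1 + s)) :
    ∃ y v : ℝ → E, y 0 = z ∧ Continuous v ∧ (∀ t, HasDerivAt y (v t) t) ∧
      ∀ t, 0 ≤ t → v t = F y t := by
  have hM : 0 ≤ M := by simpa using (norm_nonneg _).trans (hz 0 le_rfl)
  have hcw := continuous_volterraWeight K
  -- The unknown is `u = (y - z) / weight`, sought among bounded functions.
  let Y : (ℝ →ᵇ E) → ℝ → E := fun u t => z + volterraWeight K t • u t
  have hY : ∀ u, Continuous (Y u) := fun u => by
    have := u.continuous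
    fun_prop
  have hYsub : ∀ u₁ u₂ : ℝ →ᵇ E, ∀ s, 0 ≤ s →
      ‖F (Y u₁) s - F (Y u₂) s‖ ≤ (K * ‖u₁ - u₂‖) * ((1 + s) * volterraWeight K s) := by
    intro u₁ u₂ s hs
    refine (hlip _ _ (hY u₁) (hY u₂) s hs (volterraWeight K s * ‖u₁ - u₂‖) ?_).trans
      (le_of_eq (by ring))
    intro r hr hrs
    have : Y u₁ r - Y u₂ r = volterraWeight K r • (u₁ - u₂) r := by
      simp [Y, smul_sub]
    rw [this, norm_smul, Real.norm_of_nonneg (volterraWeight_pos K r).le]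
    exact mul_le_mul (volterraWeight_mono hK hr hrs) ((u₁ - u₂).norm_coe_le_norm r)
      (norm_nonneg _) (volterraWeight_pos K s).le
  have hYbd : ∀ u : ℝ →ᵇ E, ∀ s, 0 ≤ s →
      ‖F (Y u) s‖ ≤ (M + K * ‖u‖) * ((1 + s) * volterraWeight K s) := by
    intro u s hs
    have h0 : Y 0 = fun _ => z := by ext t; simp [Y]
    have h1 := hYsub u 0 s hs
    rw [h0, sub_zero] at h1
    have h2 := hz s hs
    have h3 : M * (1 + s) ≤ M * ((1 + s) * volterraWeight K s) :=
      mul_le_mul_of_nonneg_left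
        (le_mul_of_one_le_right (by positivity) (one_le_volterraWeight hK hs)) hM
    calc ‖F (Y u) s‖ = ‖F (fun _ => z) s + (F (Y u) s - F (fun _ => z) s)‖ := by congr 1; abel
      _ ≤ ‖F (fun _ => z) s‖ + ‖F (Y u) s - F (fun _ => z) s‖ := norm_add_le _ _
      _ ≤ _ := by linarith
  have hint : ∀ u, ∀ a b, IntervalIntegrable (F (Y u)) MeasureTheory.volume a b := fun u a b =>
    (hcont _ (hY u)).intervalIntegrable a b
  -- `max t 0` makes the operator constant on negative times, where no estimate is available, so
  -- that bounded continuous functions on all of `ℝ` can be used.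
  let I : (ℝ →ᵇ E) → ℝ → E := fun u t =>
    (volterraWeight K (max t 0))⁻¹ • ∫ s in (0 : ℝ)..max t 0, F (Y u) s
  have hIc : ∀ u, Continuous (I u) := fun u => by
    have h1 : Continuous fun t : ℝ => ∫ s in (0 : ℝ)..t, F (Y u) s :=
      intervalIntegral.continuous_primitive (hint u) 0
    have h2 : Continuous fun t : ℝ => max t 0 := by fun_prop
    exact ((hcw.comp h2).inv₀ fun t => (volterraWeight_pos K _).ne').smul (h1.comp h2)
  have hscale : ∀ (c : ℝ) (t : ℝ) (x : E), ‖x‖ ≤ c * (volterraWeight K t / (2 * K)) →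
      ‖(volterraWeight K t)⁻¹ • x‖ ≤ c / (2 * K) := by
    intro c t x hx
    have hw := volterraWeight_pos K t
    rw [norm_smul, norm_inv, Real.norm_of_nonneg hw.le, inv_mul_le_iff₀ hw]
    exact hx.trans (le_of_eq (by ring))
  have hIb : ∀ u t, ‖I u t‖ ≤ (M + K * ‖u‖) / (2 * K) := fun u t =>
    hscale _ _ _ (norm_integral_le_volterraWeight hK (by positivity) (le_max_right t 0) (hYbd u))
  let Φ : (ℝ →ᵇ E) → (ℝ →ᵇ E) := fun u =>
    BoundedContinuousFunction.ofNormedAddCommGroup (I u) (hIc u) _ (hIb u)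
  have hΦ : ContractingWith (1 / 2) Φ := by
    refine ⟨by norm_num, LipschitzWith.of_dist_le_mul fun u₁ u₂ => ?_⟩
    rw [dist_eq_norm u₁]
    refine (BoundedContinuousFunction.dist_le (by positivity)).2 fun t => ?_
    have h1 : Φ u₁ t - Φ u₂ t = (volterraWeight K (max t 0))⁻¹ •
        ∫ s in (0 : ℝ)..max t 0, (F (Y u₁) s - F (Y u₂) s) := by
      rw [intervalIntegral.integral_sub (hint _ _ _) (hint _ _ _), smul_sub]
      rfl
    rw [dist_eq_norm, h1]
    refine (hscale _ _ _ (norm_integral_le_volterraWeight hK (by positivity)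
      (le_max_right t 0) (hYsub u₁ u₂))).trans (le_of_eq ?_)
    push_cast
    field_simp
  obtain ⟨u, hu⟩ : ∃ u, Φ u = u := ⟨_, hΦ.fixedPoint_isFixedPt⟩
  let y : ℝ → E := fun t => z + ∫ s in (0 : ℝ)..t, F (Y u) s
  have hy : ∀ t, HasDerivAt y (F (Y u) t) t := fun t =>
    (intervalIntegral.integral_hasDerivAt_right (hint u 0 t)
      ((hcont _ (hY u)).stronglyMeasurableAtFilter _ _) (hcont _ (hY u)).continuousAt).const_add z
  have hyY : ∀ t, 0 ≤ t → y t = Y u t := by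
    intro t ht
    have h1 : u t = I u t := (DFunLike.congr_fun hu t).symm
    have h2 : I u t = (volterraWeight K t)⁻¹ • ∫ s in (0 : ℝ)..t, F (Y u) s := by
      simp only [I, max_eq_left ht]
    simp only [Y, y, h1, h2, smul_smul, mul_inv_cancel₀ (volterraWeight_pos K t).ne', one_smul]
  refine ⟨y, F (Y u), by simp [y], hcont _ (hY u), hy, fun t ht => ?_⟩
  have hyc : Continuous y := continuous_iff_continuousAt.2 fun t => (hy t).continuousAt
  -- `y` and `Y u` may differ at negative times; causality with `D = 0` shows that `F` does not
  -- notice.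
  have h := hlip (Y u) y (hY u) hyc t ht 0 fun r hr _ => by rw [hyY r hr]; simp
  rw [mul_zero] at h
  exact sub_eq_zero.1 (norm_le_zero_iff.1 h)

end Volterra

/-! ### The damped equation in integral form -/

section DampedODE

variable {E : Type*} [NormedAddCommGroup E] [NormedSpace ℝ E]

/-- The scaled moment `∫₀¹ τ ^ a G(y(s τ)) dτ`. -/
noncomputable def scaledMoment (G : E → E) (a : ℝ) (y : ℝ → E) (s : ℝ) : E :=
  ∫ τ in (0 : ℝ)..1, τ ^ a • G (y (s * τ))

theorem continuous_moment_integrand {G : E → E} (hG : Continuous G) {a : ℝ} (ha : 0 ≤ a)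
    {y : ℝ → E} (hy : Continuous y) :
    Continuous fun p : ℝ × ℝ => p.2 ^ a • G (y (p.1 * p.2)) := by
  have h1 : Continuous fun p : ℝ × ℝ => p.2 ^ a := continuous_snd.rpow_const fun _ => Or.inr ha
  fun_prop

theorem continuous_scaledMoment {G : E → E} (hG : Continuous G) {a : ℝ} (ha : 0 ≤ a)
    {y : ℝ → E} (hy : Continuous y) : Continuous (scaledMoment G a y) :=
  intervalIntegral.continuous_parametric_intervalIntegral_of_continuous
    (f := fun s τ : ℝ => τ ^ a • G (y (s * τ))) (continuous_moment_integrand hG ha hy)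
      continuous_const

theorem norm_scaledMoment_sub_le {G : E → E} {L : ℝ≥0} (hG : LipschitzWith L G) {a : ℝ}
    (ha : 0 ≤ a) {y₁ y₂ : ℝ → E} (h₁ : Continuous y₁) (h₂ : Continuous y₂) {s D : ℝ} (hs : 0 ≤ s)
    (hD : ∀ r, 0 ≤ r → r ≤ s → ‖y₁ r - y₂ r‖ ≤ D) :
    ‖scaledMoment G a y₁ s - scaledMoment G a y₂ s‖ ≤ L * D := by
  have hi : ∀ y : ℝ → E, Continuous y → IntervalIntegrable
      (fun τ : ℝ => τ ^ a • G (y (s * τ))) MeasureTheory.volume 0 1 := fun y hy =>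
    ((continuous_moment_integrand hG.continuous ha hy).comp
      (Continuous.prodMk_right s)).intervalIntegrable _ _
  rw [scaledMoment, scaledMoment, ← intervalIntegral.integral_sub (hi _ h₁) (hi _ h₂)]
  have := intervalIntegral.norm_integral_le_of_norm_le_const (a := (0 : ℝ)) (b := 1)
    (C := L * D) (f := fun τ : ℝ => τ ^ a • G (y₁ (s * τ)) - τ ^ a • G (y₂ (s * τ))) ?_
  · simpa using this
  intro τ hτ
  rw [Set.uIoc_of_le zero_le_one] at hτ
  rw [← smul_sub, norm_smul, Real.norm_of_nonneg (Real.rpow_nonneg hτ.1.le a)]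
  have h1 : τ ^ a ≤ 1 := Real.rpow_le_one hτ.1.le hτ.2 ha
  have h2 := hG.norm_sub_le (y₁ (s * τ)) (y₂ (s * τ))
  have h3 := hD (s * τ) (mul_nonneg hs hτ.1.le) (mul_le_of_le_one_right hs hτ.2)
  calc τ ^ a * ‖G (y₁ (s * τ)) - G (y₂ (s * τ))‖
      ≤ 1 * (L * ‖y₁ (s * τ) - y₂ (s * τ)‖) :=
        mul_le_mul h1 h2 (norm_nonneg _) zero_le_one
    _ ≤ L * D := by rw [one_mul]; gcongr

theorem scaledMoment_const (G : E → E) [CompleteSpace E] {a : ℝ} (ha : 0 ≤ a) (z : E) (s : ℝ) :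
    scaledMoment G a (fun _ => z) s = (a + 1)⁻¹ • G z := by
  rw [scaledMoment, intervalIntegral.integral_smul_const, integral_rpow (Or.inl (by linarith))]
  simp [Real.zero_rpow (by linarith : a + 1 ≠ 0)]

theorem scaledMoment_zero (G : E → E) [CompleteSpace E] {a : ℝ} (ha : 0 ≤ a) (y : ℝ → E) :
    scaledMoment G a y 0 = (a + 1)⁻¹ • G (y 0) := by
  rw [← scaledMoment_const G ha (y 0) 0]
  simp [scaledMoment]

theorem scaledMoment_eq (G : E → E) {a : ℝ} (y : ℝ → E) {s : ℝ} (hs : 0 < s) :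
    scaledMoment G a y s = s ^ (-(a + 1)) • ∫ r in (0 : ℝ)..s, r ^ a • G (y r) := by
  have h := intervalIntegral.integral_comp_mul_left (a := 0) (b := 1)
    (fun r : ℝ => r ^ a • G (y r)) hs.ne'
  have h2 : ∫ τ in (0 : ℝ)..1, (s * τ) ^ a • G (y (s * τ)) = s ^ a • scaledMoment G a y s := by
    rw [scaledMoment, ← intervalIntegral.integral_smul]
    refine intervalIntegral.integral_congr fun τ hτ => ?_
    rw [Set.uIcc_of_le zero_le_one] at hτ
    simp only [Real.mul_rpow hs.le hτ.1, smul_smul]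
  rw [h2, mul_zero, mul_one] at h
  have h3 : s ^ a ≠ 0 := (Real.rpow_pos_of_pos hs a).ne'
  rw [Real.rpow_neg hs.le, Real.rpow_add hs, Real.rpow_one, mul_inv, mul_smul, ← h, smul_smul,
    inv_mul_cancel₀ h3, one_smul]

theorem hasDerivAt_scaledMoment [CompleteSpace E] {G : E → E} (hG : Continuous G) {a : ℝ}
    (ha : 0 ≤ a) {y : ℝ → E} (hy : Continuous y) {s : ℝ} (hs : 0 < s) :
    HasDerivAt (scaledMoment G a y)
      (s⁻¹ • G (y s) - ((a + 1) / s) • scaledMoment G a y s) s := by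
  have hc : Continuous fun r : ℝ => r ^ a • G (y r) := by
    have h1 : Continuous fun r : ℝ => r ^ a := continuous_id.rpow_const fun _ => Or.inr ha
    fun_prop
  have h1 : HasDerivAt (fun s => ∫ r in (0 : ℝ)..s, r ^ a • G (y r)) (s ^ a • G (y s)) s :=
    intervalIntegral.integral_hasDerivAt_right (hc.intervalIntegrable _ _)
      (hc.stronglyMeasurableAtFilter _ _) hc.continuousAt
  have h2 : HasDerivAt (fun s : ℝ => s ^ (-(a + 1))) (-(a + 1) * s ^ (-(a + 1) - 1)) s :=
    Real.hasDerivAt_rpow_const (Or.inl hs.ne')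
  have h3 := h2.smul h1
  have h4 : HasDerivAt (scaledMoment G a y) _ s := h3.congr_of_eventuallyEq (by
    filter_upwards [lt_mem_nhds hs] with r hr using scaledMoment_eq G y hr)
  refine h4.congr_deriv ?_
  rw [scaledMoment_eq G y hs, smul_smul, smul_smul, ← Real.rpow_add hs,
    Real.rpow_sub hs, Real.rpow_one]
  have : -(a + 1) + a = -1 := by ring
  rw [this, Real.rpow_neg_one, sub_eq_add_neg, ← neg_smul]
  congr 2
  ring

/-- Integral form of `y'' + (α / t) y' + G(y) + β (G ∘ y)' = 0` as a first-order causal equation. -/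
noncomputable def dampedVelocity (G : E → E) (α β : ℝ) (y : ℝ → E) (s : ℝ) : E :=
  -(β • G (y s)) + (α * β) • scaledMoment G (α - 1) y s - s • scaledMoment G α y s

/-- The formula comes from `(t^α y')' = -t^α (G(y) + β (G ∘ y)')`: integrate from `0`, integrate the
last term by parts, divide by `t^α`. No derivative of `G` remains, so a Lipschitz `G` suffices for
solvability; differentiating back restores the Hessian term. -/
theorem hasDerivAt_dampedVelocity [CompleteSpace E] {G : E → E} (hG : ContDiff ℝ 1 G) {α : ℝ}
    (β : ℝ) (hα : 1 ≤ α) {y : ℝ → E} {y' : E} (hy : Continuous y) {s : ℝ} (hs : 0 < s)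
    (hy' : HasDerivAt y y' s) :
    HasDerivAt (dampedVelocity G α β y)
      (-(α / s) • dampedVelocity G α β y s - G (y s) - β • fderiv ℝ G (y s) y') s := by
  have h1 : HasDerivAt (fun s => G (y s)) (fderiv ℝ G (y s) y') s :=
    ((hG.differentiable one_ne_zero) (y s)).hasFDerivAt.comp_hasDerivAt s hy'
  have h2 := hasDerivAt_scaledMoment hG.continuous (sub_nonneg.2 hα) hy hs
  have h3 := hasDerivAt_scaledMoment hG.continuous (zero_le_one.trans hα) hy hs
  have h4 := ((h1.const_smul β).neg.add (h2.const_smul (α * β))).sub ((hasDerivAt_id s).smul h3)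
  refine HasDerivAt.congr_deriv (f := dampedVelocity G α β y) h4 ?_
  simp only [dampedVelocity, id]
  match_scalars <;> field_simp <;> ring

theorem exists_dampedVelocity_solution [CompleteSpace E] {G : E → E} {L : ℝ≥0}
    (hL : 0 < L) (hG : LipschitzWith L G) {α β : ℝ} (hα : 1 ≤ α) (hβ : 0 < β) (z : E) :
    ∃ y v : ℝ → E, y 0 = z ∧ Continuous v ∧ (∀ t, HasDerivAt y (v t) t) ∧
      ∀ t, 0 ≤ t → v t = dampedVelocity G α β y t := by
  have hα1 : 0 ≤ α - 1 := by linarith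
  have hα0 : 0 ≤ α := by linarith
  have hL' : (0 : ℝ) < L := hL
  have hGc := hG.continuous
  -- The three terms have total Lipschitz constant `L * (β + α * β + s)` at time `s`. On a constant
  -- path the two `β` terms cancel, leaving `-(s / (α + 1)) • G z`.
  refine exists_volterra_solution (K := L * (β + α * β + 1)) (M := ‖G z‖) (by positivity)
    ?_ ?_ ?_
  · intro y hy
    have h1 := continuous_scaledMoment hGc hα1 hy
    have h2 := continuous_scaledMoment hGc hα0 hy
    unfold dampedVelocity
    fun_prop
  · intro y₁ y₂ h₁ h₂ s hs D hD
    have e1 := norm_scaledMoment_sub_le hG hα1 h₁ h₂ hs hD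
    have e2 := norm_scaledMoment_sub_le hG hα0 h₁ h₂ hs hD
    have e3 : ‖G (y₁ s) - G (y₂ s)‖ ≤ L * D :=
      (hG.norm_sub_le _ _).trans (by gcongr; exact hD s hs le_rfl)
    have hD0 : 0 ≤ D := (norm_nonneg _).trans (hD s hs le_rfl)
    have e4 : dampedVelocity G α β y₁ s - dampedVelocity G α β y₂ s =
        -(β • (G (y₁ s) - G (y₂ s)))
        + (α * β) • (scaledMoment G (α - 1) y₁ s - scaledMoment G (α - 1) y₂ s)
        - s • (scaledMoment G α y₁ s - scaledMoment G α y₂ s) := by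
      simp only [dampedVelocity]; module
    rw [e4]
    refine (norm_sub_le _ _).trans ((add_le_add_left (norm_add_le _ _) _).trans ?_)
    rw [norm_neg, norm_smul, norm_smul, norm_smul, Real.norm_of_nonneg hβ.le,
      Real.norm_of_nonneg (by positivity : 0 ≤ α * β), Real.norm_of_nonneg hs]
    calc _ ≤ β * (L * D) + α * β * (L * D) + s * (L * D) := by gcongr
      _ = (β + α * β + s) * (L * D) := by ring
      _ ≤ ((β + α * β + 1) * (1 + s)) * (L * D) := by
        gcongr
        nlinarith [mul_nonneg (by positivity : 0 ≤ β + α * β) hs]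
      _ = _ := by ring
  · intro s hs
    have e : dampedVelocity G α β (fun _ => z) s = -(s * (α + 1)⁻¹) • G z := by
      simp only [dampedVelocity, scaledMoment_const G hα1, scaledMoment_const G hα0]
      have : α ≠ 0 := by positivity
      match_scalars
      field_simp
      ring
    rw [e, norm_smul, norm_neg, Real.norm_of_nonneg (by positivity), mul_comm]
    gcongr
    have : (α + 1)⁻¹ ≤ 1 := inv_le_one_of_one_le₀ (by linarith)
    nlinarith

end DampedODE

/-! ### Existence of the solutions `y_z` -/

namespace DinAvd

variable {n : ℕ} {φ : EuclideanSpace ℝ (Fin n) → ℝ}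

theorem contDiff_gradient (hφ : ContDiff ℝ 2 φ) : ContDiff ℝ 1 (gradient φ) :=
  (InnerProductSpace.toDual ℝ (EuclideanSpace ℝ (Fin n))).symm.contDiff.comp
    (hφ.fderiv_right (m := 1) (by norm_num))

theorem exists_isSolution {L : ℝ≥0} (hL : 0 < L) (hφ : ContDiff ℝ 2 φ)
    (hLip : LipschitzWith L (gradient φ)) {α β : ℝ} (hα : 1 ≤ α) (hβ : 0 < β)
    (z : EuclideanSpace ℝ (Fin n)) : ∃ y, IsSolution φ α β z y := by
  obtain ⟨y, v, hz, hv, hy, hvy⟩ := exists_dampedVelocity_solution hL hLip hα hβ z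
  have hG := contDiff_gradient hφ
  have hyd : deriv y = v := funext fun t => (hy t).deriv
  have hyC : ContDiff ℝ 1 y :=
    contDiff_one_iff_deriv.2 ⟨fun t => (hy t).differentiableAt, by rwa [hyd]⟩
  have hyc := hyC.continuous
  have hv' : ∀ t, 0 < t → HasDerivAt v
      (-(α / t) • v t - gradient φ (y t) - β • hessian φ (y t) (v t)) t := by
    intro t ht
    have h1 := hasDerivAt_dampedVelocity hG β hα hyc ht (hy t)
    rw [← hvy t ht.le] at h1
    refine h1.congr_of_eventuallyEq ?_
    filter_upwards [lt_mem_nhds ht] with r hr using hvy r hr.le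
  refine ⟨y, hyC.contDiffOn, ?_, hz, ?_, ?_⟩
  · rw [show (2 : WithTop ℕ∞) = 1 + 1 by norm_num,
      contDiffOn_succ_iff_deriv_of_isOpen isOpen_Ioi, hyd]
    refine ⟨fun t _ => (hy t).differentiableAt.differentiableWithinAt, by simp, ?_⟩
    rw [show (1 : WithTop ℕ∞) = 0 + 1 by norm_num, contDiffOn_succ_iff_deriv_of_isOpen isOpen_Ioi]
    refine ⟨fun t ht => (hv' t ht).differentiableAt.differentiableWithinAt, by simp, ?_⟩
    rw [contDiffOn_zero]
    have h1 : ContinuousOn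
        (fun t => -(α / t) • v t - gradient φ (y t) - β • hessian φ (y t) (v t))
        (Set.Ioi 0) := by
      have h2 : Continuous fun t => hessian φ (y t) :=
        (hG.continuous_fderiv one_ne_zero).comp hyc
      have h3 : Continuous fun t => gradient φ (y t) := hG.continuous.comp hyc
      have h4 : ContinuousOn (fun t : ℝ => -(α / t)) (Set.Ioi 0) :=
        (continuousOn_const.div continuousOn_id fun t ht => (Set.mem_Ioi.1 ht).ne').neg
      exact ((h4.smul hv.continuousOn).sub h3.continuousOn).sub
        ((h2.clm_apply hv).const_smul β).continuousOn
    exact h1.congr fun t ht => (hv' t ht).deriv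
  · have h0 : v 0 = 0 := by
      rw [hvy 0 le_rfl]
      simp only [dampedVelocity, scaledMoment_zero _ (sub_nonneg.2 hα), zero_smul, sub_add_cancel]
      have hα0 : α ≠ 0 := (zero_lt_one.trans_le hα).ne'
      match_scalars
      field_simp
      simp
    exact h0 ▸ (hy 0).hasDerivWithinAt
  · intro t ht
    rw [hyd, (hv' t ht).deriv]
    module

end DinAvd

/-! ### Smoothness, convexity and the energy identity -/

namespace DinAvd

variable {n : ℕ} {φ : EuclideanSpace ℝ (Fin n) → ℝ}

open scoped InnerProductSpace

theorem hasDerivAt_comp_gradient (hφ : ContDiff ℝ 2 φ) {y : ℝ → EuclideanSpace ℝ (Fin n)}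
    {y' : EuclideanSpace ℝ (Fin n)} {t : ℝ} (hy : HasDerivAt y y' t) :
    HasDerivAt (fun s => φ (y s)) ⟪gradient φ (y t), y'⟫_ℝ t := by
  have h := ((hφ.differentiable two_ne_zero) (y t)).hasFDerivAt.comp_hasDerivAt t hy
  rwa [← inner_gradient_left] at h

theorem hasDerivAt_gradient_comp (hφ : ContDiff ℝ 2 φ) {y : ℝ → EuclideanSpace ℝ (Fin n)}
    {y' : EuclideanSpace ℝ (Fin n)} {t : ℝ} (hy : HasDerivAt y y' t) :
    HasDerivAt (fun s => gradient φ (y s)) (hessian φ (y t) y') t :=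
  (((contDiff_gradient hφ).differentiable one_ne_zero) (y t)).hasFDerivAt.comp_hasDerivAt t hy

theorem norm_hessian_le {L : ℝ≥0} (hLip : LipschitzWith L (gradient φ))
    (x v : EuclideanSpace ℝ (Fin n)) : ‖hessian φ x v‖ ≤ L * ‖v‖ :=
  (hessian φ x).le_of_opNorm_le (norm_fderiv_le_of_lipschitz ℝ hLip) v

theorem hasDerivAt_line (x v : EuclideanSpace ℝ (Fin n)) (s : ℝ) :
    HasDerivAt (fun s : ℝ => x + s • v) v s := by
  simpa using ((hasDerivAt_id s).smul_const v).const_add x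

/-- On a line through `x`, convexity makes the directional derivative monotone; its slope at `x` is
the Hessian form. -/
theorem inner_hessian_nonneg (hconv : ConvexOn ℝ Set.univ φ) (hφ : ContDiff ℝ 2 φ)
    (x v : EuclideanSpace ℝ (Fin n)) : 0 ≤ ⟪hessian φ x v, v⟫_ℝ := by
  have hl := hasDerivAt_line x v
  have hd := fun s => hasDerivAt_comp_gradient hφ (hl s)
  have hc : ConvexOn ℝ Set.univ fun s : ℝ => φ (x + s • v) := by
    have := hconv.comp_affineMap (AffineMap.lineMap x (x + v))
    simp only [Set.preimage_univ] at this
    refine this.congr fun s _ => ?_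
    simp [AffineMap.lineMap_apply, add_comm]
  have hm : Monotone fun s : ℝ => ⟪gradient φ (x + s • v), v⟫_ℝ := by
    have := hc.monotoneOn_deriv fun s _ => (hd s).differentiableAt
    rw [monotoneOn_univ] at this
    convert this using 1
    exact funext fun s => (hd s).deriv.symm
  have hdd := (hasDerivAt_gradient_comp hφ (hl 0)).inner ℝ (hasDerivAt_const (0 : ℝ) v)
  have := hm.deriv_nonneg (x := (0 : ℝ))
  rw [hdd.deriv] at this
  simpa using this

theorem gradient_eq_zero_of_mem_argmin {x : EuclideanSpace ℝ (Fin n)} (hx : x ∈ argmin φ) :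
    gradient φ x = 0 := by
  have h : IsLocalMin φ x := Filter.Eventually.of_forall hx
  simp [gradient, h.fderiv_eq_zero]

theorem mem_argmin_iff {φstar : ℝ} (h : IsLeast (Set.range φ) φstar)
    {x : EuclideanSpace ℝ (Fin n)} : x ∈ argmin φ ↔ φ x = φstar := by
  obtain ⟨⟨p, rfl⟩, h2⟩ := h
  exact ⟨fun hx => le_antisymm (hx p) (h2 ⟨x, rfl⟩), fun hx y => hx ▸ h2 ⟨y, rfl⟩⟩

theorem apply_le_of_gradient_eq_zero {L : ℝ≥0} (hφ : ContDiff ℝ 2 φ)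
    (hLip : LipschitzWith L (gradient φ)) {p : EuclideanSpace ℝ (Fin n)}
    (hp : gradient φ p = 0) (x : EuclideanSpace ℝ (Fin n)) :
    φ x - φ p ≤ L / 2 * dist x p ^ 2 := by
  have hl := hasDerivAt_line p (x - p)
  have h1 : ∀ s, HasDerivAt (fun s : ℝ => φ (p + s • (x - p)) - L / 2 * s ^ 2 * ‖x - p‖ ^ 2)
      (⟪gradient φ (p + s • (x - p)), x - p⟫_ℝ - L * s * ‖x - p‖ ^ 2) s := fun s => by
    refine ((hasDerivAt_comp_gradient hφ (hl s)).sub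
      (((hasDerivAt_id s).pow 2).const_mul ((L : ℝ) / 2) |>.mul_const (‖x - p‖ ^ 2))).congr_deriv ?_
    simp only [id_eq, Nat.cast_ofNat, Nat.add_one_sub_one, pow_one, mul_one]
    ring
  have h2 : AntitoneOn (fun s : ℝ => φ (p + s • (x - p)) - L / 2 * s ^ 2 * ‖x - p‖ ^ 2)
      (Set.Ici 0) := by
    refine antitoneOn_of_deriv_nonpos (convex_Ici 0)
      (fun s _ => (h1 s).continuousAt.continuousWithinAt)
      (fun s _ => (h1 s).differentiableAt.differentiableWithinAt) fun s hs => ?_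
    rw [interior_Ici] at hs
    rw [(h1 s).deriv]
    have h3 := hLip.norm_sub_le (p + s • (x - p)) p
    rw [hp, sub_zero, add_sub_cancel_left, norm_smul, Real.norm_of_nonneg (le_of_lt hs)] at h3
    have h4 := real_inner_le_norm (gradient φ (p + s • (x - p))) (x - p)
    have h5 := mul_le_mul_of_nonneg_right h3 (norm_nonneg (x - p))
    nlinarith
  have := h2 (Set.mem_Ici.2 le_rfl) (Set.mem_Ici.2 zero_le_one) zero_le_one
  simp at this
  rw [dist_eq_norm]
  linarith

theorem sub_le_infDist_sq {L : ℝ≥0} (hφ : ContDiff ℝ 2 φ) (hLip : LipschitzWith L (gradient φ))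
    {φstar : ℝ} (h : IsLeast (Set.range φ) φstar) (x : EuclideanSpace ℝ (Fin n)) :
    φ x - φstar ≤ L / 2 * Metric.infDist x (argmin φ) ^ 2 := by
  have hset : argmin φ = φ ⁻¹' {φstar} := Set.ext fun x => mem_argmin_iff h
  have hclosed : IsClosed (argmin φ) := hset ▸ isClosed_singleton.preimage hφ.continuous
  have hne : (argmin φ).Nonempty := by
    obtain ⟨p, hp⟩ := h.1
    exact ⟨p, (mem_argmin_iff h).2 hp⟩
  obtain ⟨p, hp, hd⟩ := hclosed.exists_infDist_eq_dist hne x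
  rw [hd, ← (mem_argmin_iff h).1 hp]
  exact apply_le_of_gradient_eq_zero hφ hLip (gradient_eq_zero_of_mem_argmin hp) x

/-- A solution together with its velocity `V`, continuous up to time `0`, and acceleration `A`. -/
structure IsMotion (φ : EuclideanSpace ℝ (Fin n) → ℝ) (α β : ℝ) (z : EuclideanSpace ℝ (Fin n))
    (y V A : ℝ → EuclideanSpace ℝ (Fin n)) : Prop where
  position_zero : y 0 = z
  velocity_zero : V 0 = 0
  continuousOn_position : ContinuousOn y (Set.Ici 0)
  continuousOn_velocity : ContinuousOn V (Set.Ici 0)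
  hasDerivWithinAt_position : ∀ t, 0 ≤ t → HasDerivWithinAt y (V t) (Set.Ici 0) t
  hasDerivAt_velocity : ∀ t, 0 < t → HasDerivAt V (A t) t
  continuousOn_acceleration : ContinuousOn A (Set.Ioi 0)
  acceleration_eq : ∀ t, 0 < t →
    A t = -((α / t) • V t) - gradient φ (y t) - β • hessian φ (y t) (V t)

theorem IsMotion.hasDerivAt_position {α β : ℝ} {z : EuclideanSpace ℝ (Fin n)}
    {y V A : ℝ → EuclideanSpace ℝ (Fin n)} (h : IsMotion φ α β z y V A) {t : ℝ} (ht : 0 < t) :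
    HasDerivAt y (V t) t :=
  (h.hasDerivWithinAt_position t ht.le).hasDerivAt (Ici_mem_nhds ht)

/-- The one-sided derivative serves as velocity because `y` is unconstrained at negative times, so
`deriv y 0` carries no information. The last conjunct translates the restart criterion into the sign
of `⟪V, A⟫`. -/
theorem IsSolution.exists_isMotion {α β : ℝ} {z : EuclideanSpace ℝ (Fin n)}
    {y : ℝ → EuclideanSpace ℝ (Fin n)} (h : IsSolution φ α β z y) :
    ∃ V A, IsMotion φ α β z y V A ∧
      ∀ t, 0 < t → deriv (fun s => ‖deriv y s‖ ^ 2) t = 2 * ⟪V t, A t⟫_ℝ := by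
  have hV : ∀ t, 0 < t → derivWithin y (Set.Ici 0) t = deriv y t := fun t ht =>
    derivWithin_of_mem_nhds (Ici_mem_nhds ht)
  have h2 := h.contDiffOn_Ioi
  rw [show (2 : WithTop ℕ∞) = 1 + 1 by norm_num,
    contDiffOn_succ_iff_deriv_of_isOpen isOpen_Ioi] at h2
  have h3 := h2.2.2
  rw [show (1 : WithTop ℕ∞) = 0 + 1 by norm_num,
    contDiffOn_succ_iff_deriv_of_isOpen isOpen_Ioi] at h3
  have hA : ∀ t, 0 < t → HasDerivAt (deriv y) (deriv (deriv y) t) t := fun t ht =>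
    ((h3.1 t ht).differentiableAt (Ioi_mem_nhds ht)).hasDerivAt
  refine ⟨derivWithin y (Set.Ici 0), deriv (deriv y), ⟨h.initial_position, ?_,
    h.contDiffOn_Ici.continuousOn, ?_, ?_, ?_, ?_, ?_⟩, ?_⟩
  · exact h.initial_velocity.derivWithin (uniqueDiffOn_Ici 0 0 (Set.mem_Ici.2 le_rfl))
  · exact h.contDiffOn_Ici.continuousOn_derivWithin (uniqueDiffOn_Ici 0) le_rfl
  · exact fun t ht => ((h.contDiffOn_Ici.differentiableOn one_ne_zero) t ht).hasDerivWithinAt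
  · intro t ht
    refine (hA t ht).congr_of_eventuallyEq ?_
    filter_upwards [lt_mem_nhds ht] with r hr using hV r hr
  · exact contDiffOn_zero.1 h3.2.2
  · intro t ht
    rw [hV t ht]
    have := h.equation t ht
    rw [← sub_eq_zero, ← this]
    abel
  · intro t ht
    rw [hV t ht, (hA t ht).norm_sq.deriv]

namespace IsMotion

variable {α β : ℝ} {z : EuclideanSpace ℝ (Fin n)} {y V A : ℝ → EuclideanSpace ℝ (Fin n)}

theorem inner_gradient_velocity (h : IsMotion φ α β z y V A) {t : ℝ} (ht : 0 < t) :
    ⟪gradient φ (y t), V t⟫_ℝ =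
      -⟪V t, A t⟫_ℝ - α / t * ‖V t‖ ^ 2 - β * ⟪hessian φ (y t) (V t), V t⟫_ℝ := by
  have : gradient φ (y t) = -A t - (α / t) • V t - β • hessian φ (y t) (V t) := by
    rw [h.acceleration_eq t ht]; abel
  conv_lhs => rw [this]
  rw [inner_sub_left, inner_sub_left, inner_neg_left, inner_smul_left, inner_smul_left,
    real_inner_self_eq_norm_sq, real_inner_comm]
  simp

theorem apply_le (h : IsMotion φ α β z y V A) (hconv : ConvexOn ℝ Set.univ φ)
    (hφ : ContDiff ℝ 2 φ) (hα : 0 ≤ α) (hβ : 0 ≤ β) {t : ℝ} (ht : 0 ≤ t) :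
    φ (y t) + ‖V t‖ ^ 2 / 2 ≤ φ z := by
  have hd : ∀ s, 0 < s → HasDerivAt (fun s => φ (y s) + ‖V s‖ ^ 2 / 2)
      (⟪gradient φ (y s), V s⟫_ℝ + 2 * ⟪V s, A s⟫_ℝ / 2) s := fun s hs =>
    (hasDerivAt_comp_gradient hφ (h.hasDerivAt_position hs)).add
      ((h.hasDerivAt_velocity s hs).norm_sq.div_const 2)
  have hanti : AntitoneOn (fun s => φ (y s) + ‖V s‖ ^ 2 / 2) (Set.Ici 0) := by
    refine antitoneOn_of_deriv_nonpos (convex_Ici 0) ?_ ?_ ?_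
    · exact (hφ.continuous.comp_continuousOn h.continuousOn_position).add
        ((h.continuousOn_velocity.norm.pow 2).div_const 2)
    · intro s hs
      rw [interior_Ici] at hs
      exact (hd s hs).differentiableAt.differentiableWithinAt
    · intro s hs
      rw [interior_Ici] at hs
      rw [(hd s hs).deriv, h.inner_gradient_velocity hs]
      have h1 := mul_nonneg hβ (inner_hessian_nonneg hconv hφ (y s) (V s))
      have h2 : 0 ≤ α / s * ‖V s‖ ^ 2 :=
        mul_nonneg (div_nonneg hα (le_of_lt hs)) (sq_nonneg _)
      linarith
  have := hanti (Set.mem_Ici.2 le_rfl) (Set.mem_Ici.2 ht) ht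
  simpa [h.position_zero, h.velocity_zero] using this

/-- While the speed is nondecreasing, the energy identity gives `(φ ∘ y)' ≤ -(α / t) * c ^ 2`; the
logarithm is the integral of `1 / t`. -/
theorem add_log_le (h : IsMotion φ α β z y V A) (hconv : ConvexOn ℝ Set.univ φ)
    (hφ : ContDiff ℝ 2 φ) (hα : 0 ≤ α) (hβ : 0 ≤ β) {a b c : ℝ} (ha : 0 < a) (hab : a ≤ b)
    (hc : 0 ≤ c) (hVA : ∀ t, a < t → t < b → 0 ≤ ⟪V t, A t⟫_ℝ)
    (hV : ∀ t, a < t → t < b → c ≤ ‖V t‖) :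
    φ (y b) + α * c ^ 2 * Real.log (b / a) ≤ φ (y a) := by
  have hd : ∀ s, 0 < s → HasDerivAt (fun s => φ (y s) + α * c ^ 2 * Real.log s)
      (⟪gradient φ (y s), V s⟫_ℝ + α * c ^ 2 * s⁻¹) s := fun s hs =>
    (hasDerivAt_comp_gradient hφ (h.hasDerivAt_position hs)).add
      ((Real.hasDerivAt_log hs.ne').const_mul _)
  have hanti : AntitoneOn (fun s => φ (y s) + α * c ^ 2 * Real.log s) (Set.Icc a b) := by
    refine antitoneOn_of_deriv_nonpos (convex_Icc a b)
      (fun s hs => (hd s (ha.trans_le hs.1)).continuousAt.continuousWithinAt) ?_ ?_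
    · intro s hs
      rw [interior_Icc] at hs
      exact (hd s (ha.trans hs.1)).differentiableAt.differentiableWithinAt
    · intro s hs
      rw [interior_Icc] at hs
      have hs0 := ha.trans hs.1
      rw [(hd s hs0).deriv, h.inner_gradient_velocity hs0]
      have h1 := mul_nonneg hβ (inner_hessian_nonneg hconv hφ (y s) (V s))
      have h2 := hVA s hs.1 hs.2
      have h3 : α * c ^ 2 * s⁻¹ ≤ α / s * ‖V s‖ ^ 2 := by
        have : c ^ 2 ≤ ‖V s‖ ^ 2 := pow_le_pow_left₀ hc (hV s hs.1 hs.2) 2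
        calc α * c ^ 2 * s⁻¹ = α / s * c ^ 2 := by ring
          _ ≤ _ := by gcongr
      linarith
  have := hanti (Set.left_mem_Icc.2 hab) (Set.right_mem_Icc.2 hab) hab
  rw [Real.log_div (ha.trans_le hab).ne' ha.ne']
  simp only at this
  linarith

theorem norm_velocity_mono (h : IsMotion φ α β z y V A) {a b : ℝ} (ha : 0 < a) (hab : a ≤ b)
    (hVA : ∀ t, a < t → t < b → 0 ≤ ⟪V t, A t⟫_ℝ) : ‖V a‖ ≤ ‖V b‖ := by
  have hmono : MonotoneOn (fun s => ‖V s‖ ^ 2) (Set.Icc a b) := by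
    have hd := fun s hs => (h.hasDerivAt_velocity s hs).norm_sq
    refine monotoneOn_of_deriv_nonneg (convex_Icc a b)
      (fun s hs => (hd s (ha.trans_le hs.1)).continuousAt.continuousWithinAt) ?_ ?_
    · intro s hs
      rw [interior_Icc] at hs
      exact (hd s (ha.trans hs.1)).differentiableAt.differentiableWithinAt
    · intro s hs
      rw [interior_Icc] at hs
      rw [(hd s (ha.trans hs.1)).deriv]
      have := hVA s hs.1 hs.2
      positivity
  exact le_of_sq_le_sq (hmono (Set.left_mem_Icc.2 hab) (Set.right_mem_Icc.2 hab) hab)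
    (norm_nonneg _)

end IsMotion

end DinAvd

/-! ### Short-time behaviour of the motion -/

namespace DinAvd

variable {n : ℕ} {φ : EuclideanSpace ℝ (Fin n) → ℝ}

open scoped InnerProductSpace

namespace IsMotion

variable {α β : ℝ} {z : EuclideanSpace ℝ (Fin n)} {y V A : ℝ → EuclideanSpace ℝ (Fin n)}

theorem norm_position_sub_le (h : IsMotion φ α β z y V A) {t N : ℝ}
    (hN : ∀ s, 0 ≤ s → s ≤ t → ‖V s‖ ≤ N) {s : ℝ} (hs : 0 ≤ s) (hst : s ≤ t) :
    ‖y s - z‖ ≤ N * s := by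
  have := norm_image_sub_le_of_norm_deriv_le_segment' (f := y) (f' := V) (a := 0) (b := t) (C := N)
    (fun r hr => (h.hasDerivWithinAt_position r hr.1).mono fun _ hx => hx.1)
    (fun r hr => hN r hr.1 hr.2.le) s ⟨hs, hst⟩
  simpa [h.position_zero] using this

/-- The integrating factor `s ^ α` removes the singular damping: `f` below has derivative of norm at
most `D * s ^ α`, and `f 0 = 0`. -/
theorem norm_velocity_sub_le (h : IsMotion φ α β z y V A) (hα : 0 ≤ α)
    {g : EuclideanSpace ℝ (Fin n)} {t D : ℝ} (ht : 0 < t)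
    (hD : ∀ s, 0 < s → s < t →
      ‖g - gradient φ (y s) - β • hessian φ (y s) (V s)‖ ≤ D) :
    ‖V t + (t / (α + 1)) • g‖ ≤ t / (α + 1) * D := by
  have hα1 : 0 < α + 1 := by linarith
  let f : ℝ → EuclideanSpace ℝ (Fin n) := fun s => s ^ α • V s + (s ^ (α + 1) / (α + 1)) • g
  have hpow : ∀ s : ℝ, HasDerivAt (fun s : ℝ => s ^ (α + 1) / (α + 1)) (s ^ α) s := fun s =>
    ((Real.hasDerivAt_rpow_const (Or.inr (by linarith))).div_const (α + 1)).congr_deriv (by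
      rw [add_sub_cancel_right]; field_simp)
  have hf : ∀ s, 0 < s → HasDerivAt f
      (s ^ α • (g - gradient φ (y s) - β • hessian φ (y s) (V s))) s := by
    intro s hs
    refine (((Real.hasDerivAt_rpow_const (p := α) (Or.inl hs.ne')).smul
      (h.hasDerivAt_velocity s hs)).add ((hpow s).smul_const g)).congr_deriv ?_
    rw [h.acceleration_eq s hs, Real.rpow_sub_one hs.ne']
    module
  have hf0 : f 0 = 0 := by
    simp [f, h.velocity_zero, Real.zero_rpow hα1.ne']
  set w := f t with hw
  -- Pairing with the endpoint value `w = f t` reduces the vector estimate to a scalar one, ending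
  -- in `‖w‖ ^ 2 ≤ ‖w‖ * D * t ^ (α + 1) / (α + 1)`.
  have hanti : AntitoneOn (fun s => ⟪w, f s⟫_ℝ - ‖w‖ * D * (s ^ (α + 1) / (α + 1)))
      (Set.Icc 0 t) := by
    have hd : ∀ s, 0 < s → HasDerivAt
        (fun s => ⟪w, f s⟫_ℝ - ‖w‖ * D * (s ^ (α + 1) / (α + 1)))
        (⟪w, s ^ α • (g - gradient φ (y s) - β • hessian φ (y s) (V s))⟫_ℝ
          - ‖w‖ * D * s ^ α) s := fun s hs => by
      have := ((hasDerivAt_const s w).inner ℝ (hf s hs)).sub ((hpow s).const_mul (‖w‖ * D))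
      refine this.congr_deriv ?_
      simp
    refine antitoneOn_of_deriv_nonpos (convex_Icc 0 t) ?_ ?_ ?_
    · have hV : ContinuousOn V (Set.Icc 0 t) := h.continuousOn_velocity.mono fun _ hx => hx.1
      have h1 : Continuous fun s : ℝ => s ^ α := continuous_id.rpow_const fun _ => Or.inr hα
      have h2 : Continuous fun s : ℝ => s ^ (α + 1) / (α + 1) :=
        continuous_iff_continuousAt.2 fun s => (hpow s).continuousAt
      have h3 : ContinuousOn f (Set.Icc 0 t) :=
        (h1.continuousOn.smul hV).add (h2.smul continuous_const).continuousOn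
      exact (continuousOn_const.inner h3).sub (h2.const_mul _).continuousOn
    · intro s hs
      rw [interior_Icc] at hs
      exact (hd s hs.1).differentiableAt.differentiableWithinAt
    · intro s hs
      rw [interior_Icc] at hs
      rw [(hd s hs.1).deriv, inner_smul_right]
      have h1 := (real_inner_le_norm w
        (g - gradient φ (y s) - β • hessian φ (y s) (V s))).trans
          (mul_le_mul_of_nonneg_left (hD s hs.1 hs.2) (norm_nonneg w))
      have h2 := mul_le_mul_of_nonneg_left h1 (Real.rpow_nonneg hs.1.le α)
      linarith
  have h1 := hanti (Set.left_mem_Icc.2 ht.le) (Set.right_mem_Icc.2 ht.le) ht.le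
  simp only [hf0, inner_zero_right, Real.zero_rpow hα1.ne', zero_div, mul_zero, sub_zero,
    ← hw, real_inner_self_eq_norm_sq] at h1
  have htα := Real.rpow_pos_of_pos ht α
  have hwe : w = t ^ α • (V t + (t / (α + 1)) • g) := by
    rw [hw]
    simp only [f, Real.rpow_add_one ht.ne']
    module
  have h2 : ‖w‖ = t ^ α * ‖V t + (t / (α + 1)) • g‖ := by
    rw [hwe, norm_smul, Real.norm_of_nonneg htα.le]
  rcases (norm_nonneg w).eq_or_lt with h0 | hpos
  · rw [← h0] at h2
    have h3 : ‖V t + (t / (α + 1)) • g‖ = 0 := by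
      simpa [htα.ne'] using h2.symm
    rw [h3]
    have : 0 ≤ D := (norm_nonneg _).trans (hD (t / 2) (by linarith) (by linarith))
    positivity
  · have h3 : ‖w‖ ≤ D * (t ^ (α + 1) / (α + 1)) := by
      refine le_of_mul_le_mul_left ?_ hpos
      linarith
    rw [h2, Real.rpow_add_one ht.ne'] at h3
    refine le_of_mul_le_mul_left (h3.trans (le_of_eq ?_)) htα
    ring

/-- For a short time, the velocity and the acceleration are close to those of the motion
`t ↦ z - t ^ 2 / (2 * (α + 1)) • gradient φ z`. -/
theorem velocity_acceleration_near (h : IsMotion φ α β z y V A)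
    {L : ℝ≥0} (hLip : LipschitzWith L (gradient φ)) (hα : 3 ≤ α) (hβ : 0 ≤ β) {t : ℝ}
    (ht : 0 < t) (hsmall : 8 * (α + 1) * (t * (L * (t + β))) ≤ 1)
    {p : EuclideanSpace ℝ (Fin n)} (hp : p = -((α + 1)⁻¹ • gradient φ z)) :
    ‖V t - t • p‖ ≤ t * (‖p‖ / 8) ∧ ‖A t - p‖ ≤ ‖p‖ / 8 := by
  -- Bootstrap on the maximal speed `N` over `[0, t]`: the deviation of the force from `g` is at
  -- most `D = L * (t + β) * N`, and smallness of `t` lets `N` be absorbed to give `N ≤ 2 * t *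
  -- ‖p‖`, hence `D ≤ ‖p‖ / 16`.
  obtain ⟨s₀, hs₀, hmax⟩ := isCompact_Icc.exists_isMaxOn (Set.nonempty_Icc.2 ht.le)
    (h.continuousOn_velocity.norm.mono fun x (hx : x ∈ Set.Icc 0 t) => hx.1)
  set N := ‖V s₀‖ with hNdef
  have hN : ∀ s, 0 ≤ s → s ≤ t → ‖V s‖ ≤ N := fun s h0 h1 => hmax ⟨h0, h1⟩
  have hN0 : 0 ≤ N := norm_nonneg _
  set g := gradient φ z with hg
  set D := L * (t + β) * N with hDdef
  have hD0 : 0 ≤ D := by positivity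
  have hα1 : 0 < α + 1 := by linarith
  have hD : ∀ s, 0 < s → s ≤ t →
      ‖g - gradient φ (y s) - β • hessian φ (y s) (V s)‖ ≤ D := by
    intro s hs hst
    have h1 : ‖g - gradient φ (y s)‖ ≤ L * (N * t) := by
      rw [norm_sub_rev]
      refine (hLip.norm_sub_le _ _).trans ?_
      have := h.norm_position_sub_le hN hs.le hst
      gcongr
      exact this.trans (by gcongr)
    have h2 : ‖β • hessian φ (y s) (V s)‖ ≤ β * (L * N) := by
      rw [norm_smul, Real.norm_of_nonneg hβ]
      have := (norm_hessian_le hLip (y s) (V s)).trans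
        (mul_le_mul_of_nonneg_left (hN s hs.le hst) L.coe_nonneg)
      gcongr
    calc _ ≤ _ := norm_sub_le _ _
      _ ≤ L * (N * t) + β * (L * N) := add_le_add h1 h2
      _ = D := by rw [hDdef]; ring
  have hgp : g = -((α + 1) • p) := by
    rw [hp, smul_neg, smul_smul, mul_inv_cancel₀ hα1.ne', one_smul, neg_neg]
  have hVp : ∀ s, 0 < s → s ≤ t → ‖V s - s • p‖ ≤ s / (α + 1) * D := by
    intro s hs hst
    have h1 := h.norm_velocity_sub_le (g := g) (by linarith) hs
      fun r h0 h1 => hD r h0 (h1.le.trans hst)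
    have h2 : V s - s • p = V s + (s / (α + 1)) • g := by
      rw [hp]; module
    rwa [h2]
  have hfrac : ∀ x : ℝ, 0 ≤ x → x / (α + 1) ≤ x / 4 := fun x hx => by gcongr; linarith
  have htD : t * D ≤ N / 32 := by
    have h1 : 8 * (α + 1) * (t * D) ≤ N := by
      have := mul_le_mul_of_nonneg_right hsmall hN0
      rw [hDdef]
      linarith
    have h2 : 32 * (t * D) ≤ 8 * (α + 1) * (t * D) := by
      gcongr
      linarith
    linarith
  have hNle : N ≤ 2 * (t * ‖p‖) := by
    have htp : 0 ≤ t * ‖p‖ := by positivity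
    rcases hs₀.1.eq_or_lt with h0 | h0
    · have : N = 0 := by rw [hNdef, ← h0, h.velocity_zero, norm_zero]
      linarith
    · have h1 := hVp s₀ h0 hs₀.2
      have h2 : N ≤ ‖V s₀ - s₀ • p‖ + ‖s₀ • p‖ := by
        simpa using norm_add_le (V s₀ - s₀ • p) (s₀ • p)
      rw [norm_smul, Real.norm_of_nonneg h0.le] at h2
      have h3 : s₀ * ‖p‖ ≤ t * ‖p‖ := by
        gcongr
        exact hs₀.2
      have h4 : s₀ / (α + 1) * D ≤ t * D / 4 := by
        rw [div_mul_eq_mul_div]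
        refine (hfrac _ (by positivity)).trans ?_
        have := mul_le_mul_of_nonneg_right hs₀.2 hD0
        linarith
      linarith
  have hDp : D ≤ ‖p‖ / 16 := by
    refine le_of_mul_le_mul_left ?_ ht
    linarith
  have hVt := hVp t ht le_rfl
  refine ⟨hVt.trans ?_, ?_⟩
  · rw [div_mul_eq_mul_div]
    refine (hfrac _ (by positivity)).trans ?_
    have := mul_le_mul_of_nonneg_left hDp ht.le
    have : 0 ≤ t * ‖p‖ := by positivity
    linarith
  · have h1 : A t - p = -((α / t) • (V t - t • p))
        + (g - gradient φ (y t) - β • hessian φ (y t) (V t)) := by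
      rw [h.acceleration_eq t ht, hgp]
      match_scalars <;> field_simp
      ring
    rw [h1]
    refine (norm_add_le _ _).trans ?_
    rw [norm_neg, norm_smul, Real.norm_of_nonneg (by positivity)]
    have h2 : α / t * ‖V t - t • p‖ ≤ D := by
      calc α / t * ‖V t - t • p‖ ≤ α / t * (t / (α + 1) * D) := by gcongr
        _ = α / (α + 1) * D := by field_simp
        _ ≤ 1 * D := by
          gcongr
          rw [div_le_one hα1]
          linarith
        _ = D := one_mul D
    have h3 := hD t ht le_rfl
    linarith

theorem speed_lower_bound (h : IsMotion φ α β z y V A)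
    {L : ℝ≥0} (hLip : LipschitzWith L (gradient φ)) (hα : 3 ≤ α) (hβ : 0 ≤ β) {t : ℝ}
    (ht : 0 < t) (hsmall : 8 * (α + 1) * (t * (L * (t + β))) ≤ 1) :
    t / (2 * (α + 1)) * ‖gradient φ z‖ ≤ ‖V t‖ := by
  obtain ⟨h1, -⟩ := h.velocity_acceleration_near hLip hα hβ ht hsmall rfl
  set p := -((α + 1)⁻¹ • gradient φ z) with hp
  have hα1 : 0 < α + 1 := by linarith
  have h2 : ‖p‖ = (α + 1)⁻¹ * ‖gradient φ z‖ := by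
    rw [hp, norm_neg, norm_smul, Real.norm_of_nonneg (by positivity)]
  have h3 : ‖t • p‖ ≤ ‖V t‖ + ‖V t - t • p‖ := by
    simpa using norm_sub_le (V t) (V t - t • p)
  rw [norm_smul, Real.norm_of_nonneg ht.le] at h3
  have h4 : t / (2 * (α + 1)) * ‖gradient φ z‖ = t * ‖p‖ / 2 := by
    rw [h2]; field_simp
  have : 0 ≤ t * ‖p‖ := by positivity
  linarith

theorem inner_velocity_acceleration_pos (h : IsMotion φ α β z y V A)
    {L : ℝ≥0} (hLip : LipschitzWith L (gradient φ)) (hα : 3 ≤ α) (hβ : 0 ≤ β) {t : ℝ}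
    (ht : 0 < t) (hsmall : 8 * (α + 1) * (t * (L * (t + β))) ≤ 1) (hz : gradient φ z ≠ 0) :
    0 < ⟪V t, A t⟫_ℝ := by
  obtain ⟨h1, h2⟩ := h.velocity_acceleration_near hLip hα hβ ht hsmall rfl
  set p := -((α + 1)⁻¹ • gradient φ z) with hp
  have hα1 : 0 < α + 1 := by linarith
  have hp0 : 0 < ‖p‖ := by
    rw [hp, norm_neg, norm_smul, norm_inv, Real.norm_of_nonneg hα1.le]
    have := norm_pos_iff.2 hz
    positivity
  have e : ⟪V t, A t⟫_ℝ = t * ‖p‖ ^ 2 + t * ⟪p, A t - p⟫_ℝ + ⟪V t - t • p, A t⟫_ℝ := by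
    rw [inner_sub_right, inner_sub_left, inner_smul_left, real_inner_self_eq_norm_sq]
    simp
    ring
  have h3 := abs_le.1 (abs_real_inner_le_norm p (A t - p))
  have h4 := abs_le.1 (abs_real_inner_le_norm (V t - t • p) (A t))
  have h5 : ‖A t‖ ≤ ‖p‖ / 8 + ‖p‖ := by
    have := norm_add_le (A t - p) p
    rw [sub_add_cancel] at this
    linarith
  have h6 : ‖V t - t • p‖ * ‖A t‖ ≤ t * (‖p‖ / 8) * (‖p‖ / 8 + ‖p‖) :=
    mul_le_mul h1 h5 (norm_nonneg _) (by positivity)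
  have h7 : t * (‖p‖ * ‖A t - p‖) ≤ t * (‖p‖ * (‖p‖ / 8)) := by gcongr
  have h8 := mul_le_mul_of_nonneg_left h3.1 ht.le
  have h9 : 0 < t * ‖p‖ ^ 2 := by positivity
  rw [e]
  nlinarith

end IsMotion

end DinAvd

/-! ### One restart cycle, and iteration of the cycles -/

namespace DinAvd

variable {n : ℕ} {φ : EuclideanSpace ℝ (Fin n) → ℝ}

open scoped InnerProductSpace

/-- Quantitative effect of one restart cycle: its duration lies between two positive constants,
the gap to the minimum decreases by a fixed factor, and no minimizer is reached. -/
theorem IsMotion.restart_cycle {α β : ℝ} {z : EuclideanSpace ℝ (Fin n)}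
    {y V A : ℝ → EuclideanSpace ℝ (Fin n)} (h : IsMotion φ α β z y V A)
    (hconv : ConvexOn ℝ Set.univ φ) (hφ : ContDiff ℝ 2 φ)
    {L : ℝ≥0} (hLip : LipschitzWith L (gradient φ)) (hα : 3 ≤ α) (hβ : 0 ≤ β)
    {μ φstar τ c T : ℝ} (hμ : 0 < μ) (hmin : IsLeast (Set.range φ) φstar)
    (hPL : ∀ z, μ * (φ z - φstar) ≤ 1 / 2 * ‖gradient φ z‖ ^ 2)
    (hz : z ∉ argmin φ) (hτ : 0 < τ) (hsmall : 8 * (α + 1) * (τ * (L * (τ + β))) ≤ 1)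
    (hc : c = τ / (2 * (α + 1))) (hT : T = sInf {t | 0 < t ∧ ⟪V t, A t⟫_ℝ ≤ 0}) :
    τ ≤ T ∧ T ≤ τ * Real.exp (1 / (2 * μ * α * c ^ 2)) + 1 ∧
      φ (y T) - φstar ≤ Real.exp (-(μ * α * c ^ 2 / 2 * Real.log 2)) * (φ z - φstar) ∧
      y T ∉ argmin φ := by
  have hα0 : 0 < α := by linarith
  have hc0 : 0 < c := by rw [hc]; positivity
  have hstar : ∀ x, φstar ≤ φ x := fun x => hmin.2 ⟨x, rfl⟩
  set g := gradient φ z with hgdef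
  have hgap : 0 < φ z - φstar :=
    sub_pos.2 ((hstar z).lt_of_ne' fun he => hz ((mem_argmin_iff hmin).2 he))
  have hg2 : 0 < ‖g‖ ^ 2 := by
    have := hPL z
    have := mul_pos hμ hgap
    linarith
  have hg : g ≠ 0 := fun h0 => by simp [h0] at hg2
  have hsmall' : ∀ s, 0 < s → s ≤ τ → 8 * (α + 1) * (s * (L * (s + β))) ≤ 1 := by
    intro s hs hsτ
    refine le_trans ?_ hsmall
    gcongr
  have hpos : ∀ s, 0 < s → s ≤ τ → 0 < ⟪V s, A s⟫_ℝ := fun s hs hsτ =>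
    h.inner_velocity_acceleration_pos hLip hα hβ hs (hsmall' s hs hsτ) hg
  have hVτ : c * ‖g‖ ≤ ‖V τ‖ := by
    have := h.speed_lower_bound hLip hα hβ hτ hsmall
    rwa [← hc] at this
  -- This horizon makes `log (M / τ) > 1 / (2 * μ * α * c ^ 2)`, the `+ 1` giving strictness.
  -- Nondecreasing speed up to `M` would then cost `φ` more than `‖g‖ ^ 2 / (2 * μ)`, which already
  -- bounds the gap.
  set M := τ * Real.exp (1 / (2 * μ * α * c ^ 2)) + 1 with hM
  have hMτ : τ ≤ M := by
    have h1 : 1 ≤ Real.exp (1 / (2 * μ * α * c ^ 2)) := Real.one_le_exp (by positivity)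
    nlinarith
  have hz_le : ∀ t, 0 ≤ t → φ (y t) ≤ φ z := fun t ht => by
    have := h.apply_le hconv hφ hα0.le hβ ht
    have := sq_nonneg ‖V t‖
    linarith
  set S := {t | 0 < t ∧ ⟪V t, A t⟫_ℝ ≤ 0} with hS
  have hbdd : BddBelow S := ⟨0, fun t ht => ht.1.le⟩
  obtain ⟨t₁, ht₁, ht₁M⟩ : ∃ t ∈ S, t ≤ M := by
    by_contra! hcon
    have hVA : ∀ t, 0 < t → t ≤ M → 0 ≤ ⟪V t, A t⟫_ℝ := fun t ht htM => by
      by_contra! hneg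
      exact (hcon t ⟨ht, hneg.le⟩).not_ge htM
    have h1 := h.add_log_le hconv hφ hα0.le hβ (c := c * ‖g‖) hτ hMτ (by positivity)
      (fun t h1 h2 => hVA t (hτ.trans h1) h2.le)
      (fun t h1 h2 => hVτ.trans (h.norm_velocity_mono hτ h1.le fun r h3 h4 =>
        hVA r (hτ.trans h3) (h4.le.trans h2.le)))
    have h2 : 1 / (2 * μ * α * c ^ 2) < Real.log (M / τ) := by
      rw [Real.lt_log_iff_exp_lt (by positivity), lt_div_iff₀ hτ, hM]
      linarith
    have h3 := hstar (y M)
    have h4 := hz_le τ hτ.le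
    have h5 := hPL z
    have h6 := mul_lt_mul_of_pos_left h2 (by positivity : 0 < μ * (α * (c * ‖g‖) ^ 2))
    have h7 : μ * (α * (c * ‖g‖) ^ 2) * (1 / (2 * μ * α * c ^ 2)) = 1 / 2 * ‖g‖ ^ 2 := by
      field_simp
    rw [h7] at h6
    have h8 : μ * (α * (c * ‖g‖) ^ 2 * Real.log (M / τ)) ≤ μ * (φ z - φstar) :=
      mul_le_mul_of_nonneg_left (by linarith) hμ.le
    linarith
  have hτT : τ ≤ T := by
    rw [hT]
    refine le_csInf ⟨t₁, ht₁⟩ fun t ht => ?_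
    by_contra! hlt
    exact (hpos t ht.1 hlt.le).not_ge ht.2
  have hTpos : 0 < T := hτ.trans_le hτT
  have hVA : ∀ t, 0 < t → t < T → 0 ≤ ⟪V t, A t⟫_ℝ := fun t ht htT => by
    by_contra! hneg
    exact (csInf_le hbdd (show t ∈ S from ⟨ht, hneg.le⟩)).not_gt (hT ▸ htT)
  refine ⟨hτT, hT ▸ (csInf_le hbdd ht₁).trans ht₁M, ?_, ?_⟩
  -- With `c = 0` this only says that `φ` does not increase from `τ` to `T`. The definite loss is
  -- taken on `[τ / 2, τ]`, where the speed is at least `c / 2 * ‖g‖`.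
  · have h1 := h.add_log_le hconv hφ hα0.le hβ (c := 0) hτ hτT le_rfl
      (fun t h1 h2 => hVA t (hτ.trans h1) h2) fun t _ _ => norm_nonneg _
    have h2 := h.add_log_le hconv hφ hα0.le hβ (a := τ / 2) (b := τ) (c := c / 2 * ‖g‖)
      (by positivity) (by linarith) (by positivity)
      (fun t h1 h2 => (hpos t (by linarith) h2.le).le) fun t h1 h2 => by
        have ht : 0 < t := by linarith
        refine le_trans ?_ (h.speed_lower_bound hLip hα hβ ht (hsmall' t ht h2.le))
        refine mul_le_mul_of_nonneg_right ?_ (norm_nonneg _)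
        rw [hc, div_right_comm]
        gcongr
    have h3 := hz_le (τ / 2) (by positivity)
    have h4 : τ / (τ / 2) = 2 := by field_simp
    rw [h4] at h2
    have hlog : 0 < Real.log 2 := Real.log_pos one_lt_two
    have h5 := mul_le_mul_of_nonneg_left (hPL z) (by positivity : 0 ≤ α * c ^ 2 / 2 * Real.log 2)
    have h6 := mul_le_mul_of_nonneg_right
      (Real.add_one_le_exp (-(μ * α * c ^ 2 / 2 * Real.log 2))) hgap.le
    norm_num at h1
    refine le_trans ?_ h6
    have h7 : α * (c / 2 * ‖g‖) ^ 2 * Real.log 2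
        = α * c ^ 2 / 2 * Real.log 2 * (1 / 2 * ‖g‖ ^ 2) := by ring
    rw [h7] at h2
    linarith
  -- At a minimizer the left side of the energy identity vanishes, while `⟪V T, A T⟫ ≥ 0` (limit
  -- from the left) and `V T ≠ 0` make the right side negative. This matters: a minimizer as restart
  -- point would have restart time `0`, and later times would fall into the default branch `x₀`.
  · intro hTmin
    have hV0 : 0 < ‖V T‖ := by
      refine lt_of_lt_of_le ?_ (hVτ.trans (h.norm_velocity_mono hτ hτT fun r h3 h4 =>
        hVA r (hτ.trans h3) h4))
      have := norm_pos_iff.2 hg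
      positivity
    have hge : 0 ≤ ⟪V T, A T⟫_ℝ := by
      have hcont : ContinuousAt (fun t => ⟪V t, A t⟫_ℝ) T :=
        (h.hasDerivAt_velocity T hTpos).continuousAt.inner
          (h.continuousOn_acceleration.continuousAt (Ioi_mem_nhds hTpos))
      refine ge_of_tendsto (hcont.tendsto.mono_left (nhdsWithin_le_nhds (s := Set.Iio T))) ?_
      filter_upwards [self_mem_nhdsWithin, nhdsWithin_le_nhds (lt_mem_nhds hTpos)] with t h1 h2
        using hVA t h2 h1
    have e := h.inner_gradient_velocity hTpos
    rw [gradient_eq_zero_of_mem_argmin hTmin, inner_zero_left] at e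
    have h1 := mul_nonneg hβ (inner_hessian_nonneg hconv hφ (y T) (V T))
    have h2 : 0 < α / T * ‖V T‖ ^ 2 := by positivity
    linarith

section Restart

variable {α β : ℝ}

theorem restartTime_nonneg (z : EuclideanSpace ℝ (Fin n)) : 0 ≤ restartTime φ α β z :=
  Real.sInf_nonneg fun _ ht => ht.1.le

theorem restartInstant_succ (x₀ : EuclideanSpace ℝ (Fin n)) (i : ℕ) :
    restartInstant φ α β x₀ (i + 1) =
      restartInstant φ α β x₀ i + restartTime φ α β (restartPoint φ α β x₀ i) :=
  Finset.sum_range_succ _ _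

theorem apply_solution_le (hconv : ConvexOn ℝ Set.univ φ) (hφ : ContDiff ℝ 2 φ)
    (hα : 0 ≤ α) (hβ : 0 ≤ β) (hsol : ∀ z, IsSolution φ α β z (solution φ α β z))
    (z : EuclideanSpace ℝ (Fin n)) {t : ℝ} (ht : 0 ≤ t) : φ (solution φ α β z t) ≤ φ z := by
  obtain ⟨V, A, hm, -⟩ := (hsol z).exists_isMotion
  have := hm.apply_le hconv hφ hα hβ ht
  have := sq_nonneg ‖V t‖
  linarith

theorem apply_restartPoint_le (hconv : ConvexOn ℝ Set.univ φ) (hφ : ContDiff ℝ 2 φ)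
    (hα : 0 ≤ α) (hβ : 0 ≤ β) (hsol : ∀ z, IsSolution φ α β z (solution φ α β z))
    (x₀ : EuclideanSpace ℝ (Fin n)) (i : ℕ) : φ (restartPoint φ α β x₀ i) ≤ φ x₀ := by
  induction i with
  | zero => exact le_rfl
  | succ i ih =>
    exact (apply_solution_le hconv hφ hα hβ hsol _ (restartTime_nonneg _)).trans ih

/-- The trajectory takes the value `x₀`, or lies on the solution issued from some `x_i`
with `t ≤ S_{i+1}`. -/
theorem restartedTrajectory_cases (hconv : ConvexOn ℝ Set.univ φ) (hφ : ContDiff ℝ 2 φ)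
    (hα : 0 ≤ α) (hβ : 0 ≤ β) (hsol : ∀ z, IsSolution φ α β z (solution φ α β z))
    (x₀ : EuclideanSpace ℝ (Fin n)) (t : ℝ)
    (h : ∃ i : ℕ, t ∈ Set.Ioc (restartInstant φ α β x₀ i) (restartInstant φ α β x₀ (i + 1))) :
    ∃ i, t ≤ restartInstant φ α β x₀ (i + 1) ∧
      φ (restartedTrajectory φ α β x₀ t) ≤ φ (restartPoint φ α β x₀ i) := by
  classical
  refine ⟨Nat.find h, (Nat.find_spec h).2, ?_⟩
  rw [restartedTrajectory, dif_pos h]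
  convert apply_solution_le hconv hφ hα hβ hsol _ (sub_nonneg.2 (Nat.find_spec h).1.le)

theorem apply_restartedTrajectory_le (hconv : ConvexOn ℝ Set.univ φ) (hφ : ContDiff ℝ 2 φ)
    (hα : 0 ≤ α) (hβ : 0 ≤ β) (hsol : ∀ z, IsSolution φ α β z (solution φ α β z))
    (x₀ : EuclideanSpace ℝ (Fin n)) (t : ℝ) : φ (restartedTrajectory φ α β x₀ t) ≤ φ x₀ := by
  by_cases h : ∃ i : ℕ, t ∈ Set.Ioc (restartInstant φ α β x₀ i) (restartInstant φ α β x₀ (i + 1))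
  · obtain ⟨i, -, hi⟩ := restartedTrajectory_cases hconv hφ hα hβ hsol x₀ t h
    exact hi.trans (apply_restartPoint_le hconv hφ hα hβ hsol x₀ i)
  · rw [restartedTrajectory, dif_neg h]

/-- Exponential decay along the restarted trajectory, given uniform bounds for one cycle. -/
theorem restartedTrajectory_decay (hconv : ConvexOn ℝ Set.univ φ) (hφ : ContDiff ℝ 2 φ)
    (hα : 0 ≤ α) (hβ : 0 ≤ β) (hsol : ∀ z, IsSolution φ α β z (solution φ α β z))
    {φstar τ M q : ℝ} (hmin : IsLeast (Set.range φ) φstar) (hτ : 0 < τ) (hM : 0 < M) (hq : 0 ≤ q)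
    (hcycle : ∀ z, z ∉ argmin φ → τ ≤ restartTime φ α β z ∧ restartTime φ α β z ≤ M ∧
      φ (solution φ α β z (restartTime φ α β z)) - φstar ≤ Real.exp (-q) * (φ z - φstar) ∧
      solution φ α β z (restartTime φ α β z) ∉ argmin φ)
    {x₀ : EuclideanSpace ℝ (Fin n)} (hx₀ : x₀ ∉ argmin φ) {t : ℝ} (ht : 0 < t) :
    φ (restartedTrajectory φ α β x₀ t) - φstar
      ≤ Real.exp q * Real.exp (-(q / M) * t) * (φ x₀ - φstar) := by
  have hgap : 0 ≤ φ x₀ - φstar := sub_nonneg.2 (hmin.2 ⟨x₀, rfl⟩)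
  have hne : ∀ i, restartPoint φ α β x₀ i ∉ argmin φ := fun i => by
    induction i with
    | zero => exact hx₀
    | succ i ih => exact (hcycle _ ih).2.2.2
  have hdecay : ∀ i : ℕ, φ (restartPoint φ α β x₀ i) - φstar
      ≤ Real.exp (-(q * i)) * (φ x₀ - φstar) := fun i => by
    induction i with
    | zero => simp [restartPoint]
    | succ i ih =>
      refine (hcycle _ (hne i)).2.2.1.trans
        ((mul_le_mul_of_nonneg_left ih (Real.exp_pos _).le).trans (le_of_eq ?_))
      rw [← mul_assoc, ← Real.exp_add]
      push_cast
      ring_nf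
  have hlow : ∀ i : ℕ, i * τ ≤ restartInstant φ α β x₀ i := fun i => by
    induction i with
    | zero => simp [restartInstant]
    | succ i ih =>
      have := (hcycle _ (hne i)).1
      rw [restartInstant_succ]
      push_cast
      linarith
  have hupp : ∀ i : ℕ, restartInstant φ α β x₀ i ≤ i * M := fun i => by
    induction i with
    | zero => simp [restartInstant]
    | succ i ih =>
      have := (hcycle _ (hne i)).2.1
      rw [restartInstant_succ]
      push_cast
      linarith
  have hex : ∃ i : ℕ,
      t ∈ Set.Ioc (restartInstant φ α β x₀ i) (restartInstant φ α β x₀ (i + 1)) := by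
    classical
    -- The lower bound `τ` on cycles excludes accumulation of restarts; the least such `j` is
    -- positive because `S_0 = 0 < t`.
    have hj : ∃ j : ℕ, t ≤ restartInstant φ α β x₀ j := by
      obtain ⟨j, hj⟩ := exists_nat_ge (t / τ)
      exact ⟨j, ((div_le_iff₀ hτ).1 hj).trans (hlow j)⟩
    cases hk : Nat.find hj with
    | zero =>
      have := Nat.find_spec hj
      rw [hk] at this
      simp only [restartInstant, Finset.range_zero, Finset.sum_empty] at this
      exact absurd this ht.not_ge
    | succ i =>
      exact ⟨i, not_le.1 (Nat.find_min hj (hk ▸ Nat.lt_succ_self i)), hk ▸ Nat.find_spec hj⟩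
  obtain ⟨i, hti, hi⟩ := restartedTrajectory_cases hconv hφ hα hβ hsol x₀ t hex
  refine (sub_le_sub_right hi φstar).trans ((hdecay i).trans ?_)
  rw [← Real.exp_add]
  gcongr
  have h1 := hti.trans (hupp (i + 1))
  push_cast at h1
  -- Only `i + 1 ≥ t / M` is known, since `t` may lie inside the current cycle; the lost cycle
  -- accounts for the factor `exp q`.
  have h2 : q / M * t ≤ q * (i + 1) := by
    rw [div_mul_eq_mul_div, div_le_iff₀ hM, mul_assoc]
    gcongr
  linarith

end Restart

end DinAvd

/-! ### Choice of the constants and conclusion -/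

theorem theorem2p3 (L : ℝ≥0) (hL : 0 < L) (μ : ℝ) (hμ : 0 < μ)
    (α β : ℝ) (hα : 3 ≤ α) (hβ : 0 < β) :
    ∃ C K : ℝ, 0 < C ∧ 0 < K ∧
      ∀ (n : ℕ) (φ : EuclideanSpace ℝ (Fin n) → ℝ) (φstar : ℝ),
        ConvexOn ℝ Set.univ φ →
        ContDiff ℝ 2 φ →
        LipschitzWith L (gradient φ) →
        IsLeast (Set.range φ) φstar →
        (∀ z, μ * (φ z - φstar) ≤ 1 / 2 * ‖gradient φ z‖ ^ 2) →
        ∀ (x₀ : EuclideanSpace ℝ (Fin n)) (t : ℝ), 0 < t →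
          φ (DinAvd.restartedTrajectory φ α β x₀ t) - φstar
              ≤ C * Real.exp (-K * t) * (φ x₀ - φstar) ∧
            C * Real.exp (-K * t) * (φ x₀ - φstar)
              ≤ C * (L : ℝ) / 2 * Real.exp (-K * t)
                  * Metric.infDist x₀ (DinAvd.argmin φ) ^ 2 := by
  have hα0 : 0 < α := by linarith
  have hL' : (0 : ℝ) < L := hL
  obtain ⟨τ, hτ, hsmall⟩ : ∃ τ : ℝ, 0 < τ ∧ 8 * (α + 1) * (τ * (L * (τ + β))) ≤ 1 := by
    -- The cap `τ ≤ 1` bounds `τ + β` by `1 + β`, making the smallness condition linear in `τ`.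
    refine ⟨min 1 (1 / (8 * (α + 1) * (L * (1 + β)))), lt_min one_pos (by positivity), ?_⟩
    set τ := min 1 (1 / (8 * (α + 1) * (L * (1 + β)))) with hτ
    have h1 : τ ≤ 1 := min_le_left _ _
    have h2 : τ ≤ 1 / (8 * (α + 1) * (L * (1 + β))) := min_le_right _ _
    have h0 : 0 < τ := lt_min one_pos (by positivity)
    rw [le_div_iff₀ (by positivity)] at h2
    calc 8 * (α + 1) * (τ * (L * (τ + β))) ≤ 8 * (α + 1) * (τ * (L * (1 + β))) := by gcongr
      _ = τ * (8 * (α + 1) * (L * (1 + β))) := by ring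
      _ ≤ 1 := h2
  set c := τ / (2 * (α + 1)) with hc
  set M := τ * Real.exp (1 / (2 * μ * α * c ^ 2)) + 1 with hM
  set q := μ * α * c ^ 2 / 2 * Real.log 2 with hq
  have hq0 : 0 < q := by
    have : 0 < Real.log 2 := Real.log_pos one_lt_two
    positivity
  have hM0 : 0 < M := by positivity
  refine ⟨Real.exp q, q / M, Real.exp_pos q, by positivity, ?_⟩
  intro n φ φstar hconv hφ hLip hmin hPL x₀ t ht
  have hsol : ∀ z, DinAvd.IsSolution φ α β z (DinAvd.solution φ α β z) := fun z =>
    Classical.epsilon_spec (DinAvd.exists_isSolution hL hφ hLip (by linarith) hβ z)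
  refine ⟨?_, ?_⟩
  · by_cases hx₀ : x₀ ∈ DinAvd.argmin φ
    -- For a minimizer `x₀` both gaps vanish, and monotonicity alone suffices.
    · have h1 := DinAvd.apply_restartedTrajectory_le hconv hφ hα0.le hβ.le hsol x₀ t
      rw [(DinAvd.mem_argmin_iff hmin).1 hx₀] at h1 ⊢
      simpa using h1
    · refine DinAvd.restartedTrajectory_decay hconv hφ hα0.le hβ.le hsol hmin hτ hM0 hq0.le
        (fun z hz => ?_) hx₀ ht
      obtain ⟨V, A, hm, hd⟩ := (hsol z).exists_isMotion
      refine hm.restart_cycle hconv hφ hLip hα hβ.le hμ hmin hPL hz hτ hsmall hc ?_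
      refine congrArg sInf (Set.ext fun s => and_congr_right fun hs => ?_)
      rw [hd s hs]
      constructor <;> intro h <;> linarith
  · have h1 := mul_le_mul_of_nonneg_left (DinAvd.sub_le_infDist_sq hφ hLip hmin x₀)
      (by positivity : 0 ≤ Real.exp q * Real.exp (-(q / M) * t))
    refine h1.trans (le_of_eq ?_)
    ring
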